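/- Let $G$ be a group with a finite generating set $S$, equipped with the word metric $d=d_S$, i.e. the distance between vertices in the Cayley graph $\mathrm{Cay}(G,S)$. A geodesic is the image in $G$ of a nonempty (finite or infinite) interval of $\mathbb Z$ under an isometric map; it is a geodesic segment if the interval is finite. For $A,Y\subseteq G$ let $\pi_A(Y)$ be the set of all $a\in A$ for which there is $y\in Y$ with $d(y,a)=d(y,A)$. For $D>0$, a geodesic $\gamma$ is $D$-contracting if $\operatorname{diam}\pi_\gamma(\kappa)<D$ for every geodesic $\kappa$ with $d(\gamma,\kappa)>D$. An element $g\in G$ is contracting if, for some $D>0$, there is an infinite $D$-contracting geodesic at finite Hausdorff distance from $\{g^i : i\in\mathbb Z\}$. The group $G$ is hyperbolic if, for some finite generating set, its word metric is Gromov hyperbolic. Then at least one of the following holds: 1. $G$ is hyperbolic, and there exists $D>0$ such that every geodesic is $D$-contracting; 2. $G$ contains no contracting element; 3. $G$ is not hyperbolic and contains a contracting element, and for every $D>0$ there exists a geodesic segment that is not $D$-contracting. Moreover, whenever $G$ is hyperbolic (whether or not it contains a contracting element), there exists $D>0$ such that every geodesic is $D$-contracting; and conversely, if for some $D>0$ every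 geodesic segment is $D$-contracting, then $G$ is hyperbolic. -/

import Mathlib

/-- `S` is a finite generating set of `G` (finiteness is in the type `Finset G`). -/
def Generates {G : Type*} [Group G] (S : Finset G) : Prop :=
  Subgroup.closure (S : Set G) = ⊤

/-- The word metric on `G` with respect to `S`: the graph distance between vertices of
the Cayley graph `Cay(G, S)`, whose edges join `g` and `g * s` for `s ∈ S`. -/
noncomputable def wordDist {G : Type*} [Group G] (S : Finset G) (x y : G) : ℕ :=
  (SimpleGraph.mulCayley (S : Set G)).dist x y

/-- The Gromov product `(x | y)_w` in the word metric. -/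
noncomputable def gromovProd {G : Type*} [Group G] (S : Finset G) (w x y : G) : ℝ :=
  ((wordDist S w x : ℝ) + wordDist S w y - wordDist S x y) / 2

/-- `(G, d_S)` (equivalently, the Cayley graph) is Gromov hyperbolic. -/
def IsGromovHyperbolic {G : Type*} [Group G] (S : Finset G) : Prop :=
  ∃ δ : ℝ, ∀ w x y z : G,
    min (gromovProd S w x y) (gromovProd S w y z) - δ ≤ gromovProd S w x z

/-- `G` is a hyperbolic group: it has a finite generating set whose word metric is
Gromov hyperbolic. -/
def IsHyperbolicGroup (G : Type*) [Group G] : Prop :=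
  ∃ S : Finset G, Generates S ∧ IsGromovHyperbolic S

/-- `A ⊆ G` is a geodesic (segment, ray or line): the image of a nonempty interval `I` of `ℤ`
under an isometric map into `(G, d_S)`. -/
def IsGeodesic {G : Type*} [Group G] (S : Finset G) (A : Set G) : Prop :=
  ∃ (I : Set ℤ) (f : ℤ → G), I.Nonempty ∧ I.OrdConnected ∧
    (∀ i ∈ I, ∀ j ∈ I, (wordDist S (f i) (f j) : ℤ) = |i - j|) ∧ A = f '' I

/-- `A ⊆ G` is a geodesic segment: the image of an interval `{0, …, n}` under an isometric
map into `(G, d_S)`. -/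
def IsGeodesicSegment {G : Type*} [Group G] (S : Finset G) (A : Set G) : Prop :=
  ∃ (n : ℕ) (f : ℤ → G),
    (∀ i ∈ Set.Icc (0 : ℤ) n, ∀ j ∈ Set.Icc (0 : ℤ) n,
      (wordDist S (f i) (f j) : ℤ) = |i - j|) ∧ A = f '' Set.Icc (0 : ℤ) n

/-- Nearest point projection of a point `y` to `A`: the set of all nearest points. -/
def nearestProj {G : Type*} [Group G] (S : Finset G) (A : Set G) (y : G) : Set G :=
  {a | a ∈ A ∧ ∀ b ∈ A, wordDist S y a ≤ wordDist S y b}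

/-- Nearest point projection of a set `Y` to `A`. -/
def nearestProjSet {G : Type*} [Group G] (S : Finset G) (A Y : Set G) : Set G :=
  ⋃ y ∈ Y, nearestProj S A y

/-- `A` is `D`-contracting: every geodesic `B` with `d(A, B) > D` has a projection to `A` of
diameter less than `D`. As distances are natural numbers, infima of them are attained, and so
are bounded suprema; hence both conditions may be read off from pairs of points. -/
def IsContracting {G : Type*} [Group G] (S : Finset G) (D : ℝ) (A : Set G) : Prop :=
  ∀ B : Set G, IsGeodesic S B →
    (∀ a ∈ A, ∀ b ∈ B, D < (wordDist S a b : ℝ)) →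
    ∀ p ∈ nearestProjSet S A B, ∀ q ∈ nearestProjSet S A B, (wordDist S p q : ℝ) < D

/-- `A` is an axis of `g`: an infinite geodesic at finite Hausdorff distance from the orbit
`{g ^ i | i ∈ ℤ}`. -/
def IsAxis {G : Type*} [Group G] (S : Finset G) (g : G) (A : Set G) : Prop :=
  IsGeodesic S A ∧ A.Infinite ∧ ∃ R : ℕ,
    (∀ a ∈ A, ∃ i : ℤ, wordDist S a (g ^ i) ≤ R) ∧
    (∀ i : ℤ, ∃ a ∈ A, wordDist S a (g ^ i) ≤ R)

/-- `g` is a contracting element: for some `D > 0` it has a `D`-contracting axis. -/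
def IsContractingElement {G : Type*} [Group G] (S : Finset G) (g : G) : Prop :=
  ∃ D : ℝ, 0 < D ∧ ∃ A : Set G, IsAxis S g A ∧ IsContracting S D A

/-! ### Word metric and discrete geodesic paths. -/

section WordMetric

variable {G : Type*} [Group G] {S : Finset G}

/-! Contracting elements enter only through the final case split; the content is that hyperbolicity
of `G` is equivalent to uniform contraction of `S`-geodesics, with slim triangles as the link.

If all segments are `D`-contracting, a geodesic between points with distant projections to a segment
must pass near one of those projections (`IsContracting.exists_near_proj`). Applied to part of one
side of a triangle, this gives slimness (`isSlim_of_contracting`), hence the four-point condition,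
because Gromov products then measure distances to geodesics up to a bounded error.

Conversely, slim quadrilaterals give contraction (`IsSlim.isContracting`). But hyperbolicity is
assumed only for some generating set `T`, while contraction concerns `S`-geodesics. The Morse lemma
(`IsFourPoint.exists_near_geodPath`) bridges the gap: the two word metrics are bi-Lipschitz, so `S`-
and `T`-geodesics with common endpoints stay uniformly close, and slimness passes from `T` to `S`
(`IsFourPoint.exists_isSlim`). -/

theorem wordDist_self (x : G) : wordDist S x x = 0 := SimpleGraph.dist_self

theorem wordDist_comm (x y : G) : wordDist S x y = wordDist S y x := SimpleGraph.dist_comm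

theorem mulCayley_reachable_mul (x g : G) (hg : g ∈ Subgroup.closure (S : Set G)) :
    (SimpleGraph.mulCayley (S : Set G)).Reachable x (x * g) := by
  induction hg using Subgroup.closure_induction generalizing x with
  | mem s hs =>
    by_cases h : x = x * s
    · rw [← h]
    · exact SimpleGraph.Adj.reachable
        ((SimpleGraph.mulCayley_adj' _ _ _).2 ⟨h, s, hs, Or.inl rfl⟩)
  | one => rw [mul_one]
  | mul g h _ _ ihg ihh => rw [← mul_assoc]; exact (ihg x).trans (ihh _)
  | inv g _ ih => simpa using (ih (x * g⁻¹)).symm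

theorem Generates.connected (hS : Generates S) :
    (SimpleGraph.mulCayley (S : Set G)).Connected := by
  have : Nonempty G := ⟨1⟩
  refine ⟨fun x y => ?_⟩
  have h := mulCayley_reachable_mul (S := S) x (x⁻¹ * y) (by rw [hS]; trivial)
  simpa using h

theorem Generates.triangle (hS : Generates S) (x y z : G) :
    wordDist S x z ≤ wordDist S x y + wordDist S y z :=
  hS.connected.dist_triangle

/-- `f` restricted to `{0, …, n}` is a geodesic path from `x` to `y`. -/
def IsGeodPath (S : Finset G) (f : ℤ → G) (n : ℕ) (x y : G) : Prop :=
  f 0 = x ∧ f n = y ∧ ∀ i j : ℤ, 0 ≤ i → i ≤ j → j ≤ n → (wordDist S (f i) (f j) : ℤ) = j - i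

theorem IsGeodPath.iso {f : ℤ → G} {n : ℕ} {x y : G} (h : IsGeodPath S f n x y) :
    ∀ i ∈ Set.Icc (0 : ℤ) n, ∀ j ∈ Set.Icc (0 : ℤ) n,
      (wordDist S (f i) (f j) : ℤ) = |i - j| := by
  intro i hi j hj
  rcases le_total i j with hij | hij
  · rw [h.2.2 i j hi.1 hij hj.2, abs_of_nonpos (by omega)]; ring
  · rw [wordDist_comm, h.2.2 j i hj.1 hij hi.2, abs_of_nonneg (by omega)]

theorem IsGeodPath.isGeodesicSegment {f : ℤ → G} {n : ℕ} {x y : G} (h : IsGeodPath S f n x y) :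
    IsGeodesicSegment S (f '' Set.Icc (0 : ℤ) n) :=
  ⟨n, f, h.iso, rfl⟩

theorem IsGeodesicSegment.isGeodesic {A : Set G} (h : IsGeodesicSegment S A) :
    IsGeodesic S A := by
  obtain ⟨n, f, hf, rfl⟩ := h
  exact ⟨Set.Icc 0 n, f, ⟨0, by simp⟩, Set.ordConnected_Icc, hf, rfl⟩

theorem IsGeodPath.length {f : ℤ → G} {n : ℕ} {x y : G} (h : IsGeodPath S f n x y) :
    n = wordDist S x y := by
  have := h.2.2 0 n le_rfl (by omega) le_rfl
  rw [h.1, h.2.1] at this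
  omega

theorem IsGeodPath.dist_left {f : ℤ → G} {n : ℕ} {x y : G} (h : IsGeodPath S f n x y) {i : ℤ}
    (h0 : 0 ≤ i) (hn : i ≤ n) : (wordDist S x (f i) : ℤ) = i := by
  have := h.2.2 0 i le_rfl h0 hn
  rw [h.1] at this
  omega

theorem IsGeodPath.dist_right {f : ℤ → G} {n : ℕ} {x y : G} (h : IsGeodPath S f n x y) {i : ℤ}
    (h0 : 0 ≤ i) (hn : i ≤ n) : (wordDist S (f i) y : ℤ) = n - i := by
  have := h.2.2 i n h0 hn le_rfl
  rw [h.2.1] at this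
  omega

theorem IsGeodPath.symm {f : ℤ → G} {n : ℕ} {x y : G} (h : IsGeodPath S f n x y) :
    IsGeodPath S (fun k => f (n - k)) n y x := by
  refine ⟨by simpa using h.2.1, by simpa using h.1, fun a b ha hab hb => ?_⟩
  simp only
  rw [wordDist_comm, h.2.2 _ _ (by omega) (by omega) (by omega)]
  ring

theorem wordDist_getVert_le {x y : G} (p : (SimpleGraph.mulCayley (S : Set G)).Walk x y)
    (hS : Generates S) (i k : ℕ) : wordDist S (p.getVert i) (p.getVert (i + k)) ≤ k := by
  induction k with
  | zero => simp [wordDist_self]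
  | succ k ih =>
    refine (hS.triangle _ (p.getVert (i + k)) _).trans (Nat.add_le_add ih ?_)
    rcases lt_or_ge (i + k) p.length with h | h
    · exact (SimpleGraph.dist_eq_one_iff_adj.2 (p.adj_getVert_succ h)).le
    · rw [p.getVert_of_length_le h, p.getVert_of_length_le (i := i + (k + 1)) (by omega),
        wordDist_self]
      omega

theorem Generates.exists_geodPath (hS : Generates S) (x y : G) :
    ∃ f, IsGeodPath S f (wordDist S x y) x y := by
  obtain ⟨p, hp⟩ := hS.connected.exists_walk_length_eq_dist x y
  have hp' : p.length = wordDist S x y := hp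
  refine ⟨fun i => p.getVert i.toNat, by simp, by simp [← hp'], fun i j hi hij hj => ?_⟩
  obtain ⟨i, rfl⟩ := Int.eq_ofNat_of_zero_le hi
  obtain ⟨j, rfl⟩ := Int.eq_ofNat_of_zero_le (hi.trans hij)
  simp only [Int.toNat_natCast]
  have h1 := wordDist_getVert_le p hS 0 i
  have h2 := wordDist_getVert_le p hS i (j - i)
  have h3 := wordDist_getVert_le p hS j (p.length - j)
  rw [show j + (p.length - j) = p.length by omega, p.getVert_length] at h3
  rw [show i + (j - i) = j by omega] at h2
  rw [zero_add, p.getVert_zero] at h1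
  have h4 := hS.triangle x (p.getVert i) y
  have h5 := hS.triangle (p.getVert i) (p.getVert j) y
  omega

theorem exists_mem_nearestProj {A : Set G} (hA : A.Nonempty) (y : G) :
    ∃ a, a ∈ nearestProj S A y := by
  obtain ⟨a, ha, h⟩ := WellFounded.has_min (measure fun a => wordDist S y a).wf A hA
  exact ⟨a, ha, fun b hb => not_lt.1 (h b hb)⟩

theorem IsGeodesic.exists_geodPath {A : Set G} (hA : IsGeodesic S A) {p q : G} (hp : p ∈ A)
    (hq : q ∈ A) : ∃ f n, IsGeodPath S f n p q ∧ ∀ i : ℤ, 0 ≤ i → i ≤ n → f i ∈ A := by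
  obtain ⟨I, f, -, hI, hf, rfl⟩ := hA
  obtain ⟨a, ha, rfl⟩ := hp
  obtain ⟨b, hb, rfl⟩ := hq
  have key : ∀ a ∈ I, ∀ b ∈ I, a ≤ b → ∃ g n, IsGeodPath S g n (f a) (f b) ∧
      ∀ i : ℤ, 0 ≤ i → i ≤ n → g i ∈ f '' I := by
    intro a ha b hb hab
    have hc : (((b - a).toNat : ℕ) : ℤ) = b - a := Int.toNat_of_nonneg (by omega)
    have hmem : ∀ i : ℤ, 0 ≤ i → i ≤ b - a → a + i ∈ I := fun i h0 h1 =>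
      hI.out ha hb ⟨by omega, by omega⟩
    refine ⟨fun k => f (a + k), (b - a).toNat, ⟨by simp, by simp [hc], ?_⟩, ?_⟩
    · intro i j hi hij hj
      rw [hf _ (hmem i hi (by omega)) _ (hmem j (by omega) (by omega)),
        abs_of_nonpos (by omega)]
      ring
    · intro i h0 h1
      exact ⟨_, hmem i h0 (by omega), rfl⟩
  rcases le_total a b with hab | hab
  · exact key a ha b hb hab
  · obtain ⟨g, n, hg, h⟩ := key b hb a ha hab
    exact ⟨_, n, hg.symm, fun i h0 h1 => h _ (by omega) (by omega)⟩

end WordMetric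

/-! ### Slim triangles, contraction and the four-point condition, for one generating set. -/

section Slim

variable {G : Type*} [Group G] {S : Finset G}

/-- Every side of a geodesic triangle is contained in the `η`-neighbourhood of the union of the
other two sides. -/
def IsSlim (S : Finset G) (η : ℕ) : Prop :=
  ∀ (x y z : G) (α β γ : ℤ → G) (l m n : ℕ), IsGeodPath S α l x y → IsGeodPath S β m y z →
    IsGeodPath S γ n x z → ∀ k : ℤ, 0 ≤ k → k ≤ n →
      (∃ i : ℤ, 0 ≤ i ∧ i ≤ l ∧ wordDist S (γ k) (α i) ≤ η) ∨
      (∃ i : ℤ, 0 ≤ i ∧ i ≤ m ∧ wordDist S (γ k) (β i) ≤ η)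

/-- While the path stays farther than `N` from `A`, its projections stay within `N` of `p`. So it
must approach `A`; just before it first does, it is within `N + 1` of `A` and still projects near
`p`. -/
theorem IsContracting.exists_near_proj (hS : Generates S) {D : ℝ} {N : ℕ} (hN : D ≤ N)
    {A : Set G} (hA : IsContracting S D A) {β : ℤ → G} {n : ℕ} {y z p q : G}
    (hβ : IsGeodPath S β n y z) (hp : p ∈ nearestProj S A y) (hq : q ∈ nearestProj S A z)
    (hpq : N ≤ wordDist S p q) :
    ∃ i : ℤ, 0 ≤ i ∧ i ≤ n ∧ wordDist S p (β i) ≤ 2 * N + 1 := by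
  have hfar : ∀ m : ℕ, m ≤ n → (∀ i : ℕ, i ≤ m → ∀ a ∈ A, N < wordDist S a (β i)) →
      ∀ r ∈ nearestProj S A (β m), wordDist S p r < N := by
    intro m hm h r hr
    have h0 : IsGeodPath S β m y (β m) :=
      ⟨hβ.1, rfl, fun i j hi hij hj => hβ.2.2 i j hi hij (by omega)⟩
    have := hA _ h0.isGeodesicSegment.isGeodesic (by
      rintro a ha _ ⟨i, ⟨hi0, hi1⟩, rfl⟩
      obtain ⟨i, rfl⟩ := Int.eq_ofNat_of_zero_le hi0
      have := h i (by omega) a ha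
      exact hN.trans_lt (by exact_mod_cast this)) p
      (Set.mem_biUnion ⟨0, ⟨le_rfl, by omega⟩, hβ.1⟩ hp) r
      (Set.mem_biUnion ⟨m, ⟨by omega, le_rfl⟩, rfl⟩ hr)
    exact_mod_cast this.trans_le hN
  have hex : ∃ i : ℕ, i ≤ n ∧ ∃ a ∈ A, wordDist S a (β i) ≤ N := by
    by_contra! hcon
    have := hfar n le_rfl hcon q (by rw [hβ.2.1]; exact hq)
    omega
  classical
  obtain ⟨hn, a, ha, hd⟩ := Nat.find_spec hex
  have hmin := fun k => Nat.find_min hex (m := k)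
  generalize Nat.find hex = i at *
  cases i with
  | zero =>
    refine ⟨0, le_rfl, by omega, ?_⟩
    have := hp.2 a ha
    rw [Nat.cast_zero, hβ.1, wordDist_comm] at hd
    rw [hβ.1, wordDist_comm]
    omega
  | succ i =>
    obtain ⟨r, hr⟩ := exists_mem_nearestProj (S := S) ⟨a, ha⟩ (β i)
    have h1 := hfar i (by omega) (by
      intro k hk b hb
      by_contra! hcon
      exact hmin k (by omega) ⟨by omega, b, hb, hcon⟩) r hr
    have h2 := hr.2 a ha
    have h3 := hS.triangle (β i) (β (i + 1 : ℕ)) a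
    have h4 : (wordDist S (β i) (β (i + 1 : ℕ)) : ℤ) = 1 := by
      rw [hβ.2.2 i (i + 1 : ℕ) (by omega) (by omega) (by omega)]; push_cast; ring
    have h5 := hS.triangle p r (β i)
    rw [wordDist_comm r] at h5
    rw [wordDist_comm a] at hd
    refine ⟨i, by omega, by omega, ?_⟩
    omega

/-- Project the triangle to the initial segment of `γ` ending at `γ k`: `x` and `z` go to its two
ends, `y` to some `r`. If `r` is far from `γ k`, then `β` passes near `γ k`. Otherwise `α` passes
near `r`, or `x` itself is close. -/
theorem isSlim_of_contracting (hS : Generates S) {D : ℝ} {N : ℕ} (hN : D ≤ N)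
    (h : ∀ A : Set G, IsGeodesicSegment S A → IsContracting S D A) : IsSlim S (3 * N + 1) := by
  intro x y z α β γ l m n hα hβ hγ k h0 hk
  have hA : IsGeodPath S γ k.toNat x (γ k) := by
    have hc : ((k.toNat : ℕ) : ℤ) = k := Int.toNat_of_nonneg h0
    exact ⟨hγ.1, by rw [hc], fun i j hi hij hj => hγ.2.2 i j hi hij (by omega)⟩
  have hx : x ∈ nearestProj S (γ '' Set.Icc (0 : ℤ) k.toNat) x :=
    ⟨⟨0, by simp, hγ.1⟩, fun b _ => by rw [wordDist_self]; omega⟩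
  have hz : γ k ∈ nearestProj S (γ '' Set.Icc (0 : ℤ) k.toNat) z := by
    refine ⟨⟨k, ⟨h0, by omega⟩, rfl⟩, ?_⟩
    rintro _ ⟨i, ⟨hi0, hi1⟩, rfl⟩
    have h1 := hγ.dist_right h0 hk
    have h2 := hγ.dist_right (i := i) hi0 (by omega)
    rw [wordDist_comm, wordDist_comm z]
    omega
  obtain ⟨r, hr⟩ := exists_mem_nearestProj (S := S) ⟨x, hx.1⟩ y
  have hcontr := h _ hA.isGeodesicSegment
  rcases le_or_gt N (wordDist S (γ k) r) with h1 | h1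
  · obtain ⟨i, hi0, hi1, hi⟩ := hcontr.exists_near_proj hS hN hβ.symm hz hr h1
    exact Or.inr ⟨m - i, by omega, by omega, by omega⟩
  · left
    rcases le_or_gt N (wordDist S r x) with h2 | h2
    · obtain ⟨i, hi0, hi1, hi⟩ := hcontr.exists_near_proj hS hN hα.symm hr hx h2
      have := hS.triangle (γ k) r (α (l - i))
      exact ⟨l - i, by omega, by omega, by omega⟩
    · have := hS.triangle (γ k) r x
      exact ⟨0, by omega, by omega, by rw [hα.1]; omega⟩

theorem IsGeodPath.gromovProd_le (hS : Generates S) {f : ℤ → G} {n : ℕ} {x y : G}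
    (hf : IsGeodPath S f n x y) (w : G) {i : ℤ} (h0 : 0 ≤ i) (h1 : i ≤ n) :
    gromovProd S w x y ≤ wordDist S w (f i) := by
  have e1 := hf.dist_left h0 h1
  have e2 := hf.dist_right h0 h1
  have e3 := hf.length
  have t1 := hS.triangle w (f i) x
  have t2 := hS.triangle w (f i) y
  rw [wordDist_comm (f i) x] at t1
  have : wordDist S w x + wordDist S w y ≤ 2 * wordDist S w (f i) + wordDist S x y := by omega
  have : (wordDist S w x : ℝ) + wordDist S w y ≤ 2 * wordDist S w (f i) + wordDist S x y := by
    exact_mod_cast this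
  unfold gromovProd
  linarith

/-- If `{0, …, n}` is covered by two sets, containing `0` and `n` respectively, then the two sets
meet or contain adjacent points. -/
theorem exists_adjacent_of_cover {P Q : ℤ → Prop} (n : ℕ) (h0 : P 0) (hn : Q n)
    (h : ∀ k : ℤ, 0 ≤ k → k ≤ n → P k ∨ Q k) :
    ∃ k : ℤ, 0 ≤ k ∧ k ≤ n ∧ P k ∧ (Q k ∨ k + 1 ≤ n ∧ Q (k + 1)) := by
  by_contra! hcon
  have hP : ∀ k : ℕ, k ≤ n → P k := by
    intro k
    induction k with
    | zero => exact fun _ => h0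
    | succ k ih =>
      intro hk
      refine (h _ (by omega) (by omega)).resolve_right ?_
      push_cast
      exact (hcon k (by omega) (by omega) (ih (by omega))).2 (by omega)
  exact (hcon n (by omega) le_rfl (hP n le_rfl)).1 hn

/-- By connectedness some point of `γ` is close to both other sides of the triangle with apex `w`;
adding the lengths along these sides bounds its distance to `w`. -/
theorem IsSlim.exists_near_gromovProd (hS : Generates S) {η : ℕ} (h : IsSlim S η) (w : G)
    {γ : ℤ → G} {n : ℕ} {x z : G} (hγ : IsGeodPath S γ n x z) :
    ∃ k : ℤ, 0 ≤ k ∧ k ≤ n ∧ (wordDist S w (γ k) : ℝ) ≤ gromovProd S w x z + (2 * η + 1) := by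
  obtain ⟨α, hα⟩ := hS.exists_geodPath x w
  obtain ⟨β, hβ⟩ := hS.exists_geodPath w z
  obtain ⟨k, h0, hk, ⟨i, hi0, hi1, hi⟩, hQ⟩ := exists_adjacent_of_cover n
    (P := fun k => ∃ i : ℤ, 0 ≤ i ∧ i ≤ wordDist S x w ∧ wordDist S (γ k) (α i) ≤ η)
    (Q := fun k => ∃ i : ℤ, 0 ≤ i ∧ i ≤ wordDist S w z ∧ wordDist S (γ k) (β i) ≤ η)
    ⟨0, le_rfl, by omega, by rw [hα.1, hγ.1, wordDist_self]; omega⟩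
    ⟨wordDist S w z, by omega, le_rfl, by rw [hβ.2.1, hγ.2.1, wordDist_self]; omega⟩
    (h x w z α β γ _ _ n hα hβ hγ)
  obtain ⟨j, hj0, hj1, hj⟩ :
      ∃ i : ℤ, 0 ≤ i ∧ i ≤ wordDist S w z ∧ wordDist S (γ k) (β i) ≤ η + 1 := by
    rcases hQ with ⟨j, hj0, hj1, hj⟩ | ⟨hk', j, hj0, hj1, hj⟩
    · exact ⟨j, hj0, hj1, by omega⟩
    · have h1 := hγ.2.2 k (k + 1) h0 (by omega) hk'
      have h2 := hS.triangle (γ k) (γ (k + 1)) (β j)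
      exact ⟨j, hj0, hj1, by omega⟩
  refine ⟨k, h0, hk, ?_⟩
  have a1 := hα.dist_left hi0 hi1
  have a2 := hα.dist_right hi0 hi1
  have b1 := hβ.dist_left hj0 hj1
  have b2 := hβ.dist_right hj0 hj1
  have c1 := hγ.dist_left h0 hk
  have c2 := hγ.dist_right h0 hk
  have c3 := hγ.length
  have t1 := hS.triangle (γ k) (α i) x
  have t2 := hS.triangle (γ k) (α i) w
  have t3 := hS.triangle (γ k) (β j) w
  have t4 := hS.triangle (γ k) (β j) z
  rw [wordDist_comm (γ k) x, wordDist_comm (α i) x] at t1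
  rw [wordDist_comm (γ k) w] at t2 t3
  rw [wordDist_comm (β j) w] at t3
  have a0 := wordDist_comm (S := S) x w
  have key : 2 * wordDist S w (γ k) + wordDist S x z ≤
      wordDist S w x + wordDist S w z + (4 * η + 2) := by omega
  have key : 2 * (wordDist S w (γ k) : ℝ) + wordDist S x z ≤
      wordDist S w x + wordDist S w z + (4 * η + 2) := by exact_mod_cast key
  unfold gromovProd
  linarith

theorem IsSlim.isGromovHyperbolic (hS : Generates S) {η : ℕ} (h : IsSlim S η) :
    IsGromovHyperbolic S := by
  refine ⟨3 * η + 1, fun w x y z => ?_⟩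
  obtain ⟨γ, hγ⟩ := hS.exists_geodPath x z
  obtain ⟨α, hα⟩ := hS.exists_geodPath x y
  obtain ⟨β, hβ⟩ := hS.exists_geodPath y z
  obtain ⟨k, h0, hk, hkw⟩ := h.exists_near_gromovProd hS w hγ
  rcases h x y z α β γ _ _ _ hα hβ hγ k h0 hk with ⟨i, hi0, hi1, hi⟩ | ⟨i, hi0, hi1, hi⟩
  · refine le_trans (sub_le_sub_right (min_le_left _ _) _) ?_
    have h1 := hα.gromovProd_le hS w hi0 hi1
    have h2 : (wordDist S w (α i) : ℝ) ≤ wordDist S w (γ k) + η := by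
      exact_mod_cast (hS.triangle w (γ k) (α i)).trans (by omega)
    linarith
  · refine le_trans (sub_le_sub_right (min_le_right _ _) _) ?_
    have h1 := hβ.gromovProd_le hS w hi0 hi1
    have h2 : (wordDist S w (β i) : ℝ) ≤ wordDist S w (γ k) + η := by
      exact_mod_cast (hS.triangle w (γ k) (β i)).trans (by omega)
    linarith

theorem IsSlim.isContracting (hS : Generates S) {η : ℕ} (h : IsSlim S η) {A : Set G}
    (hA : IsGeodesic S A) : IsContracting S (6 * η + 2 : ℕ) A := by
  intro B hB hAB p hp q hq
  simp only [nearestProjSet, Set.mem_iUnion] at hp hq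
  obtain ⟨y, hy, hp⟩ := hp
  obtain ⟨z, hz, hq⟩ := hq
  obtain ⟨γ, n, hγ, hγA⟩ := hA.exists_geodPath hp.1 hq.1
  obtain ⟨β, m, hβ, hβB⟩ := hB.exists_geodPath hy hz
  obtain ⟨α, hα⟩ := hS.exists_geodPath p y
  obtain ⟨ε, hε⟩ := hS.exists_geodPath p z
  obtain ⟨ζ, hζ⟩ := hS.exists_geodPath z q
  by_contra! hcon
  have hcon : 6 * η + 2 ≤ wordDist S p q := by exact_mod_cast hcon
  have hn := hγ.length
  -- This point is more than `4η` from `p` and at least `2η + 1` from `q`. Being within `2η` of `[p,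
  -- y]` would put it within `4η` of `p`, as `p` is nearest to `y`; being within `η` of `[z, q]`
  -- would put it within `2η` of `q`.
  have hm1 := hγ.dist_left (i := 4 * η + 1) (by omega) (by omega)
  have hm2 := hγ.dist_right (i := 4 * η + 1) (by omega) (by omega)
  have hmA := hγA (4 * η + 1) (by omega) (by omega)
  obtain ⟨i, h0, h1, hi⟩ | ⟨i, h0, h1, hi⟩ :=
    h p z q ε ζ γ _ _ n hε hζ hγ (4 * η + 1) (by omega) (by omega)
  · obtain ⟨j, g0, g1, hj⟩ | ⟨j, g0, g1, hj⟩ := h p y z α β ε _ _ _ hα hβ hε i h0 h1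
    · have e1 := hα.dist_left g0 g1
      have e2 := hα.dist_right g0 g1
      have e3 := hp.2 _ hmA
      have t1 := hS.triangle (γ (4 * η + 1)) (ε i) (α j)
      have t2 := hS.triangle y (α j) (γ (4 * η + 1))
      have t3 := hS.triangle p (α j) (γ (4 * η + 1))
      rw [wordDist_comm y p] at e3
      rw [wordDist_comm (α j) (γ _)] at t2 t3
      rw [wordDist_comm y (α j)] at t2
      omega
    · have t1 := hS.triangle (γ (4 * η + 1)) (ε i) (β j)
      have := hAB _ hmA _ (hβB j g0 g1)
      have : 6 * η + 2 < wordDist S (γ (4 * η + 1)) (β j) := by exact_mod_cast this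
      omega
  · have e1 := hζ.dist_left h0 h1
    have e2 := hζ.dist_right h0 h1
    have e3 := hq.2 _ hmA
    have t1 := hS.triangle z (ζ i) (γ (4 * η + 1))
    have t2 := hS.triangle (γ (4 * η + 1)) (ζ i) q
    rw [wordDist_comm (ζ i) (γ _)] at t1
    omega

end Slim

/-! ### Change of generating set: stability of geodesics. -/

section Morse

variable {G : Type*} [Group G] {S T : Finset G}

theorem wordDist_mul_left_le (hS : Generates S) (g x y : G) :
    wordDist S (g * x) (g * y) ≤ wordDist S x y := by
  obtain ⟨p, hp⟩ := hS.connected.exists_walk_length_eq_dist x y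
  let φ : SimpleGraph.mulCayley (S : Set G) →g SimpleGraph.mulCayley (S : Set G) :=
    ⟨fun x => g * x, fun h => SimpleGraph.mulCayley_adj_mul_iff_right.2 h⟩
  have h : wordDist S (g * x) (g * y) ≤ (p.map φ).length := SimpleGraph.dist_le (p.map φ)
  rw [SimpleGraph.Walk.length_map, hp] at h
  exact h

theorem exists_wordDist_le_mul (hS : Generates S) (hT : Generates T) :
    ∃ M : ℕ, ∀ x y : G, wordDist T x y ≤ M * wordDist S x y := by
  refine ⟨S.sup fun s => wordDist T 1 s, fun x y => ?_⟩
  set M := S.sup fun s => wordDist T 1 s with hM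
  have hmul : ∀ u : G, ∀ s ∈ S, wordDist T u (u * s) ≤ M := fun u s hs => by
    have h1 := wordDist_mul_left_le hT u 1 s
    rw [mul_one] at h1
    exact h1.trans (Finset.le_sup (f := fun s => wordDist T 1 s) hs)
  have hadj : ∀ u v : G, wordDist S u v = 1 → wordDist T u v ≤ M := fun u v h => by
    obtain ⟨-, s, hs, rfl | rfl⟩ :=
      (SimpleGraph.mulCayley_adj' _ _ _).1 (SimpleGraph.dist_eq_one_iff_adj.1 h)
    · exact hmul u s hs
    · rw [wordDist_comm]; exact hmul v s hs
  obtain ⟨f, hf⟩ := hS.exists_geodPath x y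
  have key : ∀ k : ℕ, k ≤ wordDist S x y → wordDist T x (f k) ≤ M * k := by
    intro k
    induction k with
    | zero => intro _; rw [Nat.cast_zero, hf.1, wordDist_self]; omega
    | succ k ih =>
      intro hk
      have h1 := hadj (f k) (f (k + 1 : ℕ)) (by
        have := hf.2.2 k (k + 1 : ℕ) (by omega) (by omega) (by omega)
        omega)
      have h2 := hT.triangle x (f k) (f (k + 1 : ℕ))
      have h3 := ih (by omega)
      rw [mul_add, mul_one]
      omega
  have := key _ le_rfl
  rwa [hf.2.1] at this

theorem sq_le_two_pow {n : ℕ} (hn : 4 ≤ n) : n * n ≤ 2 ^ n := by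
  induction n, hn using Nat.le_induction with
  | base => norm_num
  | succ n hn ih => rw [pow_succ]; nlinarith

/-- The hypothesis says that `K` is at most about `a + δ log₂ (c K)`, and linear growth beats
logarithmic. -/
theorem exists_bound_of_le_log (c a δ : ℕ) :
    ∃ B : ℕ, ∀ K : ℕ, (∀ n : ℕ, c * K ≤ 2 ^ n → K ≤ a + n * δ) → K ≤ B := by
  set n₀ := c * (a + 2 * (δ + 1)) + 4 with hn₀
  refine ⟨a + (n₀ + 1) * (δ + 1), fun K hK => ?_⟩
  by_contra! hlt
  set n := (K - a - 1) / (δ + 1) with hn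
  have h1 : n * (δ + 1) ≤ K - a - 1 := Nat.div_mul_le_self _ _
  have h2 : K - a - 1 < (n + 1) * (δ + 1) := by
    rw [mul_comm]; exact Nat.lt_mul_div_succ _ (Nat.succ_pos _)
  have h3 : n₀ ≤ n := by
    rw [hn, Nat.le_div_iff_mul_le (Nat.succ_pos _)]
    have : (n₀ + 1) * (δ + 1) = n₀ * (δ + 1) + (δ + 1) := by ring
    have : n₀ * δ.succ = n₀ * (δ + 1) := rfl
    omega
  have h4 : K ≤ a + (n + 1) * (δ + 1) := by omega
  have h5 : K ≤ (a + 2 * (δ + 1)) * n := by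
    refine h4.trans ?_
    have : 1 ≤ n := by omega
    nlinarith [Nat.mul_le_mul_left a this, Nat.mul_le_mul_left (δ + 1) this]
  have h6 : c * K ≤ 2 ^ n := by
    refine le_trans ?_ (sq_le_two_pow (n := n) (by omega))
    calc c * K ≤ c * ((a + 2 * (δ + 1)) * n) := Nat.mul_le_mul_left _ h5
      _ = c * (a + 2 * (δ + 1)) * n := by ring
      _ ≤ n * n := Nat.mul_le_mul_right _ (by omega)
  have h7 := hK n h6
  have h8 : n * δ ≤ n * (δ + 1) := Nat.mul_le_mul_left _ (by omega)
  omega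

/-- The four-point condition with a natural number as constant. -/
def IsFourPoint (T : Finset G) (δ : ℕ) : Prop :=
  ∀ w x y z : G, min (gromovProd T w x y) (gromovProd T w y z) - δ ≤ gromovProd T w x z

theorem IsGromovHyperbolic.exists_isFourPoint (h : IsGromovHyperbolic T) :
    ∃ δ : ℕ, IsFourPoint T δ := by
  obtain ⟨δ, hδ⟩ := h
  refine ⟨⌈δ⌉₊, fun w x y z => ?_⟩
  have := hδ w x y z
  have := Nat.le_ceil δ
  linarith

theorem gromovProd_comm (w x y : G) : gromovProd T w x y = gromovProd T w y x := by
  unfold gromovProd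
  rw [wordDist_comm x y]
  ring

/-- Bisection: each halving of the chain costs one `δ`, so the loss is logarithmic in its length. -/
theorem IsFourPoint.exists_gromovProd_le {δ : ℕ} (h : IsFourPoint T δ) (p : G) (f : ℤ → G)
    (n : ℕ) : ∀ a b : ℤ, a < b → b ≤ a + 2 ^ n → ∃ i, a ≤ i ∧ i < b ∧
      gromovProd T p (f i) (f (i + 1)) ≤ gromovProd T p (f a) (f b) + n * δ := by
  induction n with
  | zero =>
    intro a b hab hb
    obtain rfl : b = a + 1 := by simp at hb; omega
    exact ⟨a, le_rfl, hab, by simp⟩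
  | succ n ih =>
    intro a b hab hb
    have hδ : (0 : ℝ) ≤ δ := δ.cast_nonneg
    rcases le_or_gt b (a + 2 ^ n) with hb' | hb'
    · obtain ⟨i, h1, h2, h3⟩ := ih a b hab hb'
      exact ⟨i, h1, h2, by push_cast; linarith⟩
    · have hpos : (0 : ℤ) < 2 ^ n := by positivity
      rw [pow_succ] at hb
      have h4 := h p (f a) (f (a + 2 ^ n)) (f b)
      rcases min_choice (gromovProd T p (f a) (f (a + 2 ^ n)))
        (gromovProd T p (f (a + 2 ^ n)) (f b)) with hm | hm
      · obtain ⟨i, h1, h2, h3⟩ := ih a (a + 2 ^ n) (by omega) le_rfl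
        exact ⟨i, h1, by omega, by rw [hm] at h4; push_cast; linarith⟩
      · obtain ⟨i, h1, h2, h3⟩ := ih (a + 2 ^ n) b hb' (by omega)
        exact ⟨i, by omega, h2, by rw [hm] at h4; push_cast; linarith⟩

/-- A point of the geodesic `g` at distance at most `2 * K` from `g j` is close to the path `α` and
is joined to it outside of the `K`-ball around `g j`. -/
theorem IsGeodPath.exists_fellow {g α : ℤ → G} {n L K : ℕ} {x y : G}
    (hg : IsGeodPath T g n x y) (hα : IsGeodPath S α L x y)
    (hK : ∀ j : ℤ, 0 ≤ j → j ≤ n → ∃ i : ℤ, 0 ≤ i ∧ i ≤ L ∧ wordDist T (g j) (α i) ≤ K)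
    {j : ℤ} (hj0 : 0 ≤ j) (hjn : j ≤ n)
    (hj : ∀ i : ℤ, 0 ≤ i → i ≤ L → K ≤ wordDist T (g j) (α i)) :
    ∃ k : ℤ, 0 ≤ k ∧ k ≤ j ∧ j ≤ k + 2 * K ∧ ∃ i : ℤ, 0 ≤ i ∧ i ≤ L ∧
      wordDist T (g k) (α i) ≤ K ∧ (K : ℝ) ≤ gromovProd T (g j) (g k) (α i) := by
  rcases le_or_gt (2 * (K : ℤ)) j with h | h
  -- Stepping back by `2K` makes the product at least `(2K + K - K) / 2 = K`. If there is no room,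
  -- the common endpoint serves.
  · obtain ⟨i, h0, h1, hi⟩ := hK (j - 2 * K) (by omega) (by omega)
    refine ⟨j - 2 * K, by omega, by omega, by omega, i, h0, h1, hi, ?_⟩
    have h2 := hg.2.2 (j - 2 * K) j (by omega) (by omega) hjn
    have h3 := hj i h0 h1
    rw [wordDist_comm] at h2
    have key : 2 * K + wordDist T (g (j - 2 * K)) (α i) ≤
      wordDist T (g j) (g (j - 2 * K)) + wordDist T (g j) (α i) := by omega
    have key : 2 * (K : ℝ) + wordDist T (g (j - 2 * K)) (α i) ≤
      wordDist T (g j) (g (j - 2 * K)) + wordDist T (g j) (α i) := by exact_mod_cast key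
    unfold gromovProd
    linarith
  · refine ⟨0, le_rfl, hj0, by omega, 0, le_rfl, by omega, ?_, ?_⟩
    · rw [hg.1, hα.1, wordDist_self]; omega
    · have h3 := hj 0 le_rfl (by omega)
      have h3 : (K : ℝ) ≤ wordDist T (g j) (α 0) := by exact_mod_cast h3
      rw [hα.1] at h3 ⊢
      rw [hg.1]
      unfold gromovProd
      rw [wordDist_self]
      push_cast
      linarith

/-- Consecutive points of `α` are `M`-close in `T` and outside the `K`-ball around `p`, so their
products are at least `K - M`; bisection transfers this to the ends. -/
theorem IsFourPoint.exists_le_of_chain {δ M Λ : ℕ} (h : IsFourPoint T δ)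
    (hM : ∀ x y : G, wordDist T x y ≤ M * wordDist S x y)
    (hΛ : ∀ x y : G, wordDist S x y ≤ Λ * wordDist T x y) {α : ℤ → G} {L : ℕ} {x y p : G}
    (hα : IsGeodPath S α L x y) {K r N : ℕ}
    (hp : ∀ i : ℤ, 0 ≤ i → i ≤ L → K ≤ wordDist T p (α i)) {i₁ i₂ : ℤ} (h1 : 0 ≤ i₁)
    (h1' : i₁ ≤ L) (h2 : 0 ≤ i₂) (h2' : i₂ ≤ L) (hr : wordDist T (α i₁) (α i₂) ≤ r)
    (hN : Λ * r ≤ 2 ^ N) :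
    (K : ℝ) ≤ gromovProd T p (α i₁) (α i₂) + M + N * δ := by
  have hδ : (0 : ℝ) ≤ N * δ := by positivity
  wlog hle : i₁ ≤ i₂ generalizing i₁ i₂
  · rw [gromovProd_comm]
    exact this h2 h2' h1 h1' (by rwa [wordDist_comm]) (by omega)
  rcases hle.eq_or_lt with rfl | hlt
  · have h3 : (K : ℝ) ≤ wordDist T p (α i₁) := by exact_mod_cast hp i₁ h1 h1'
    have hM0 : (0 : ℝ) ≤ M := M.cast_nonneg
    unfold gromovProd
    rw [wordDist_self]
    push_cast
    linarith
  · have h3 : i₂ ≤ i₁ + 2 ^ N := by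
      have e1 := hα.2.2 i₁ i₂ h1 hle h2'
      have e2 := (hΛ (α i₁) (α i₂)).trans ((Nat.mul_le_mul_left Λ hr).trans hN)
      have e3 : (wordDist S (α i₁) (α i₂) : ℤ) ≤ 2 ^ N := by exact_mod_cast e2
      omega
    obtain ⟨i, hi1, hi2, hi⟩ := h.exists_gromovProd_le p α N i₁ i₂ hlt h3
    have e1 : (K : ℝ) ≤ wordDist T p (α i) := by exact_mod_cast hp i (by omega) (by omega)
    have e2 : (K : ℝ) ≤ wordDist T p (α (i + 1)) := by
      exact_mod_cast hp (i + 1) (by omega) (by omega)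
    have e3 : (wordDist T (α i) (α (i + 1)) : ℝ) ≤ M := by
      have := hα.2.2 i (i + 1) (by omega) (by omega) (by omega)
      have h4 : wordDist S (α i) (α (i + 1)) = 1 := by omega
      have := hM (α i) (α (i + 1))
      rw [h4, mul_one] at this
      exact_mod_cast this
    have hM0 : (0 : ℝ) ≤ M := M.cast_nonneg
    have e4 : (K : ℝ) - M ≤ gromovProd T p (α i) (α (i + 1)) := by
      unfold gromovProd
      linarith
    linarith

/-- Geodesics for `T` are close to geodesics for `S` with the same endpoints. -/
theorem IsFourPoint.exists_near_geodPath {δ M Λ : ℕ} (h : IsFourPoint T δ) (hT : Generates T)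
    (hM : ∀ x y : G, wordDist T x y ≤ M * wordDist S x y)
    (hΛ : ∀ x y : G, wordDist S x y ≤ Λ * wordDist T x y) :
    ∃ K : ℕ, ∀ (x y : G) (g α : ℤ → G) (n L : ℕ), IsGeodPath T g n x y → IsGeodPath S α L x y →
      ∀ j : ℤ, 0 ≤ j → j ≤ n → ∃ i : ℤ, 0 ≤ i ∧ i ≤ L ∧ wordDist T (g j) (α i) ≤ K := by
  -- The detour's ends on `α` are at most `K + 4K + K` apart, whence the 6; `2 * δ` pays for joining
  -- them to the geodesic.
  obtain ⟨B, hB⟩ := exists_bound_of_le_log (Λ * 6) (M + 2 * δ) δ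
  refine ⟨B, fun x y g α n L hg hα => ?_⟩
  classical
  have hex : ∃ K : ℕ, ∀ j : ℤ, 0 ≤ j → j ≤ n → ∃ i : ℤ, 0 ≤ i ∧ i ≤ L ∧
      wordDist T (g j) (α i) ≤ K := by
    refine ⟨n, fun j h0 h1 => ⟨0, le_rfl, by omega, ?_⟩⟩
    have := hg.dist_left h0 h1
    rw [hα.1, wordDist_comm]
    omega
  have hspec := Nat.find_spec hex
  have hmin := fun k => Nat.find_min hex (m := k)
  generalize Nat.find hex = K at *
  suffices hKB : K ≤ B from fun j h0 h1 => by
    obtain ⟨i, hi0, hi1, hi⟩ := hspec j h0 h1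
    exact ⟨i, hi0, hi1, hi.trans hKB⟩
  refine hB K fun N hN => ?_
  rcases Nat.eq_zero_or_pos K with rfl | hpos
  · omega
  -- By minimality of `K`, some `g j` has all of `α` at distance at least `K`. A detour along `α`
  -- then joins points of `g` on either side of `g j`, whose product at `g j` is 0.
  have hfail := hmin (K - 1) (by omega)
  push Not at hfail
  obtain ⟨j, hj0, hjn, hj⟩ := hfail
  have hj : ∀ i : ℤ, 0 ≤ i → i ≤ L → K ≤ wordDist T (g j) (α i) := fun i h0 h1 => by
    have := hj i h0 h1
    omega
  obtain ⟨k₁, a1, a2, a3, i₁, b1, b2, b3, b4⟩ := hg.exists_fellow hα hspec hj0 hjn hj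
  have hsub : ((n : ℤ) - ((n : ℤ) - j)) = j := by ring
  obtain ⟨k₂, c1, c2, c3, i₂, d1, d2, d3, d4⟩ := hg.symm.exists_fellow hα.symm
    (fun j h0 h1 => by
      obtain ⟨i, e0, e1, e2⟩ := hspec (n - j) (by omega) (by omega)
      exact ⟨L - i, by omega, by omega, by simpa using e2⟩) (j := n - j) (by omega) (by omega)
    (fun i h0 h1 => by
      simp only [hsub]
      exact hj _ (by omega) (by omega))
  simp only [hsub] at d3 d4
  set u := g (n - k₂)
  have e1 : (wordDist T (g k₁) u : ℤ) = _ := hg.2.2 k₁ (n - k₂) a1 (by omega) (by omega)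
  have e2 := hg.2.2 k₁ j a1 (by omega) (by omega)
  have e3 : (wordDist T (g j) u : ℤ) = _ := hg.2.2 j (n - k₂) (by omega) (by omega) (by omega)
  have hprod : gromovProd T (g j) (g k₁) u = 0 := by
    have : wordDist T (g j) (g k₁) + wordDist T (g j) u = wordDist T (g k₁) u := by
      rw [wordDist_comm (g j) (g k₁)]; omega
    have : (wordDist T (g j) (g k₁) : ℝ) + wordDist T (g j) u = wordDist T (g k₁) u := by
      exact_mod_cast this
    unfold gromovProd
    linarith
  have hr : wordDist T (α i₁) (α (L - i₂)) ≤ 6 * K := by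
    have t1 := hT.triangle (α i₁) (g k₁) (α (L - i₂))
    have t2 := hT.triangle (g k₁) u (α (L - i₂))
    rw [wordDist_comm (α i₁) (g k₁)] at t1
    omega
  have hchain := h.exists_le_of_chain hM hΛ hα hj b1 b2 (i₂ := L - i₂) (by omega) (by omega) hr
    (by rw [← mul_assoc]; exact hN)
  have f1 := h (g j) (g k₁) (α i₁) u
  have f2 := h (g j) (α i₁) (α (L - i₂)) u
  rw [gromovProd_comm _ u] at d4
  have hN0 : (0 : ℝ) ≤ N * δ := by positivity
  have hM0 : (0 : ℝ) ≤ M := M.cast_nonneg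
  have hδ0 : (0 : ℝ) ≤ δ := δ.cast_nonneg
  have : (K : ℝ) ≤ M + 2 * δ + N * δ := by
    rw [hprod] at f1
    rcases min_choice (gromovProd T (g j) (g k₁) (α i₁)) (gromovProd T (g j) (α i₁) u)
      with hm | hm <;> rw [hm] at f1
    · linarith
    rcases min_choice (gromovProd T (g j) (α i₁) (α (L - i₂)))
      (gromovProd T (g j) (α (L - i₂)) u) with hm | hm <;> rw [hm] at f2 <;> linarith
  exact_mod_cast this

/-! ### Slimness from the four-point condition, and its transfer to `S`. -/

theorem IsFourPoint.exists_near_gromovProd {δ : ℕ} (h : IsFourPoint T δ) (hT : Generates T)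
    {g : ℤ → G} {n : ℕ} {x y : G} (hg : IsGeodPath T g n x y) (p : G) :
    ∃ j : ℤ, 0 ≤ j ∧ j ≤ n ∧
      (wordDist T p (g j) : ℝ) ≤ gromovProd T p x y + 2 * δ + 1 := by
  have hn := hg.length
  have t1 := hT.triangle x p y
  have t2 := hT.triangle p x y
  have t3 := hT.triangle x y p
  have c1 := wordDist_comm (S := T) x p
  have c2 := wordDist_comm (S := T) y p
  -- Up to rounding, `j` is the product of `p` and `y` at `x`; it balances the two terms of the
  -- minimum below.
  obtain ⟨j, hj0, hjn, hj1, hj2⟩ : ∃ j : ℤ, 0 ≤ j ∧ j ≤ n ∧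
      2 * j ≤ wordDist T p x + n - wordDist T p y ∧
      wordDist T p x + n - wordDist T p y ≤ 2 * j + 1 :=
    ⟨(wordDist T p x + n - wordDist T p y) / 2, by omega, by omega, by omega, by omega⟩
  refine ⟨j, hj0, hjn, ?_⟩
  have e1 := hg.dist_left hj0 hjn
  have e2 := hg.dist_right hj0 hjn
  have hf := h (g j) x p y
  have hj1 : 2 * (j : ℝ) ≤ wordDist T p x + n - wordDist T p y := by exact_mod_cast hj1
  have hj2 : (wordDist T p x : ℝ) + n - wordDist T p y ≤ 2 * j + 1 := by exact_mod_cast hj2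
  have e1 : (wordDist T x (g j) : ℝ) = j := by exact_mod_cast e1
  have e2 : (wordDist T (g j) y : ℝ) = n - j := by exact_mod_cast e2
  have hn : (n : ℝ) = wordDist T x y := by exact_mod_cast hn
  unfold gromovProd at hf ⊢
  rw [wordDist_comm (g j) x, wordDist_comm (g j) p, wordDist_comm x p, e1, e2] at hf
  rcases min_choice (((j : ℝ) + wordDist T p (g j) - wordDist T p x) / 2)
    ((wordDist T p (g j) + (n - j) - wordDist T p y) / 2) with hm | hm <;>
    rw [hm] at hf <;> linarith

theorem IsFourPoint.slim {δ : ℕ} (h : IsFourPoint T δ) (hT : Generates T) :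
    IsSlim T (3 * δ + 1) := by
  intro x y z α β γ l m n hα hβ hγ k h0 hk
  have e1 := hγ.dist_left h0 hk
  have e2 := hγ.dist_right h0 hk
  have hprod : gromovProd T (γ k) x z = 0 := by
    have hn := hγ.length
    rw [wordDist_comm] at e1
    have : wordDist T (γ k) x + wordDist T (γ k) z = wordDist T x z := by omega
    have : (wordDist T (γ k) x : ℝ) + wordDist T (γ k) z = wordDist T x z := by
      exact_mod_cast this
    unfold gromovProd
    linarith
  have hf := h (γ k) x y z
  rw [hprod] at hf
  rcases min_choice (gromovProd T (γ k) x y) (gromovProd T (γ k) y z) with hm | hm <;>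
    rw [hm] at hf
  · obtain ⟨j, hj0, hj1, hj⟩ := h.exists_near_gromovProd hT hα (γ k)
    have : (wordDist T (γ k) (α j) : ℝ) ≤ 3 * δ + 1 := by linarith
    exact Or.inl ⟨j, hj0, hj1, by exact_mod_cast this⟩
  · obtain ⟨j, hj0, hj1, hj⟩ := h.exists_near_gromovProd hT hβ (γ k)
    have : (wordDist T (γ k) (β j) : ℝ) ≤ 3 * δ + 1 := by linarith
    exact Or.inr ⟨j, hj0, hj1, by exact_mod_cast this⟩

/-- Discrete intermediate value theorem for a covering of an interval by a relation. -/
theorem exists_consecutive_related {R : ℤ → ℤ → Prop} {n L : ℕ} (h0 : R 0 0) (hn : R n L)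
    (h : ∀ j : ℤ, 0 ≤ j → j ≤ n → ∃ i : ℤ, 0 ≤ i ∧ i ≤ L ∧ R j i) {k : ℤ} (hk0 : 0 ≤ k)
    (hkL : k ≤ L) : ∃ j j' i i' : ℤ, 0 ≤ j ∧ j ≤ j' ∧ j' ≤ n ∧ j' ≤ j + 1 ∧ 0 ≤ i ∧ i ≤ k ∧
      k ≤ i' ∧ i' ≤ L ∧ R j i ∧ R j' i' := by
  obtain ⟨j, hj0, hjn, ⟨i, hi0, hik, hi⟩, ⟨i', h1, h2, h3⟩ | ⟨hjn', i', h1, h2, h3⟩⟩ :=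
    exists_adjacent_of_cover n (P := fun j => ∃ i : ℤ, 0 ≤ i ∧ i ≤ k ∧ R j i)
    (Q := fun j => ∃ i : ℤ, k ≤ i ∧ i ≤ L ∧ R j i) ⟨0, le_rfl, hk0, h0⟩ ⟨L, hkL, le_rfl, hn⟩
    (fun j hj0 hjn => by
      obtain ⟨i, hi0, hiL, hi⟩ := h j hj0 hjn
      rcases le_total i k with hik | hik
      · exact Or.inl ⟨i, hi0, hik, hi⟩
      · exact Or.inr ⟨i, hik, hiL, hi⟩)
  · exact ⟨j, j, i, i', hj0, le_rfl, hjn, by omega, hi0, hik, h1, h2, hi, h3⟩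
  · exact ⟨j, j + 1, i, i', hj0, by omega, hjn', le_rfl, hi0, hik, h1, h2, hi, h3⟩

/-- Geodesics for `S` are close to geodesics for `T` with the same endpoints, provided that the
converse holds. -/
theorem IsGeodPath.exists_near_of_near {M Λ K : ℕ} (hT : Generates T)
    (hM : ∀ x y : G, wordDist T x y ≤ M * wordDist S x y)
    (hΛ : ∀ x y : G, wordDist S x y ≤ Λ * wordDist T x y) {g α : ℤ → G} {n L : ℕ} {x y : G}
    (hg : IsGeodPath T g n x y) (hα : IsGeodPath S α L x y)
    (hK : ∀ j : ℤ, 0 ≤ j → j ≤ n → ∃ i : ℤ, 0 ≤ i ∧ i ≤ L ∧ wordDist T (g j) (α i) ≤ K)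
    {k : ℤ} (hk0 : 0 ≤ k) (hkL : k ≤ L) :
    ∃ j : ℤ, 0 ≤ j ∧ j ≤ n ∧ wordDist T (α k) (g j) ≤ M * (Λ * (2 * K + 1)) + K := by
  obtain ⟨j, j', i, i', hj0, hjj, hjn, hj1, hi0, hik, hki, hiL, h1, h2⟩ :=
    exists_consecutive_related (R := fun j i => wordDist T (g j) (α i) ≤ K) (n := n) (L := L)
      (by rw [hg.1, hα.1, wordDist_self]; omega) (by rw [hg.2.1, hα.2.1, wordDist_self]; omega)
      hK hk0 hkL
  refine ⟨j, hj0, by omega, ?_⟩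
  have e1 := hg.2.2 j j' hj0 hjj hjn
  have e2 := hα.2.2 i i' hi0 (by omega) hiL
  have e3 := hα.2.2 i k hi0 hik hkL
  have t1 := hT.triangle (α i) (g j) (α i')
  have t2 := hT.triangle (g j) (g j') (α i')
  have t3 := hT.triangle (α k) (α i) (g j)
  rw [wordDist_comm (α i) (g j)] at t1 t3
  -- `α k` lies between `α i` and `α i'`, which are within `2K + 1` in `T`.
  have h3 : wordDist S (α k) (α i) ≤ Λ * (2 * K + 1) := by
    have := (hΛ (α i) (α i')).trans (Nat.mul_le_mul_left Λ (show _ ≤ 2 * K + 1 by omega))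
    rw [wordDist_comm]
    omega
  have h4 := (hM (α k) (α i)).trans (Nat.mul_le_mul_left M h3)
  omega

theorem IsFourPoint.exists_isSlim {δ : ℕ} (h : IsFourPoint T δ) (hT : Generates T)
    (hS : Generates S) : ∃ η, IsSlim S η := by
  obtain ⟨M, hM⟩ := exists_wordDist_le_mul hS hT
  obtain ⟨Λ, hΛ⟩ := exists_wordDist_le_mul hT hS
  obtain ⟨K, hK⟩ := h.exists_near_geodPath hT hM hΛ
  refine ⟨Λ * (M * (Λ * (2 * K + 1)) + K + (3 * δ + 1) + K), ?_⟩
  intro x y z α β γ l m n hα hβ hγ k h0 hk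
  obtain ⟨α', hα'⟩ := hT.exists_geodPath x y
  obtain ⟨β', hβ'⟩ := hT.exists_geodPath y z
  obtain ⟨γ', hγ'⟩ := hT.exists_geodPath x z
  obtain ⟨j, hj0, hj1, hj⟩ :=
    hγ'.exists_near_of_near hT hM hΛ hγ (hK x z γ' γ _ n hγ' hγ) h0 hk
  have close : ∀ u v : G, wordDist T (γ' j) u ≤ 3 * δ + 1 → wordDist T u v ≤ K →
      wordDist S (γ k) v ≤ Λ * (M * (Λ * (2 * K + 1)) + K + (3 * δ + 1) + K) := by
    intro u v hu hv
    refine (hΛ _ _).trans (Nat.mul_le_mul_left Λ ?_)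
    have t1 := hT.triangle (γ k) (γ' j) v
    have t2 := hT.triangle (γ' j) u v
    omega
  rcases h.slim hT x y z α' β' γ' _ _ _ hα' hβ' hγ' j hj0 hj1 with
    ⟨i, hi0, hi1, hi⟩ | ⟨i, hi0, hi1, hi⟩
  · obtain ⟨q, hq0, hq1, hq⟩ := hK x y α' α _ l hα' hα i hi0 hi1
    exact Or.inl ⟨q, hq0, hq1, close _ _ hi hq⟩
  · obtain ⟨q, hq0, hq1, hq⟩ := hK y z β' β _ m hβ' hβ i hi0 hi1
    exact Or.inr ⟨q, hq0, hq1, close _ _ hi hq⟩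

end Morse

/-! ### The two implications and the trichotomy. -/

theorem IsHyperbolicGroup.exists_forall_isContracting {G : Type*} [Group G] {S : Finset G}
    (hS : Generates S) (hG : IsHyperbolicGroup G) :
    ∃ D : ℝ, 0 < D ∧ ∀ A : Set G, IsGeodesic S A → IsContracting S D A := by
  obtain ⟨T, hT, hyp⟩ := hG
  obtain ⟨δ, hδ⟩ := hyp.exists_isFourPoint
  obtain ⟨η, hη⟩ := hδ.exists_isSlim hT hS
  exact ⟨(6 * η + 2 : ℕ), by positivity, fun A hA => hη.isContracting hS hA⟩

theorem isHyperbolicGroup_of_isContracting {G : Type*} [Group G] {S : Finset G}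
    (hS : Generates S) {D : ℝ} (h : ∀ A : Set G, IsGeodesicSegment S A → IsContracting S D A) :
    IsHyperbolicGroup G :=
  ⟨S, hS, (isSlim_of_contracting hS (Nat.le_ceil D) h).isGromovHyperbolic hS⟩

theorem proposition3p3 {G : Type*} [Group G] (S : Finset G) (hS : Generates S) :
    -- the trichotomy, with what holds in each case
    ((IsHyperbolicGroup G ∧
        ∃ D : ℝ, 0 < D ∧ ∀ A : Set G, IsGeodesic S A → IsContracting S D A) ∨
      (¬ ∃ g : G, IsContractingElement S g) ∨
      (¬ IsHyperbolicGroup G ∧ (∃ g : G, IsContractingElement S g) ∧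
        ∀ D : ℝ, 0 < D → ∃ A : Set G, IsGeodesicSegment S A ∧ ¬ IsContracting S D A)) ∧
    -- the first case, also when there is no contracting element
    (IsHyperbolicGroup G →
      ∃ D : ℝ, 0 < D ∧ ∀ A : Set G, IsGeodesic S A → IsContracting S D A) ∧
    -- uniformly contracting segments force hyperbolicity
    ((∃ D : ℝ, 0 < D ∧ ∀ A : Set G, IsGeodesicSegment S A → IsContracting S D A) →
      IsHyperbolicGroup G) := by
  have h1 : IsHyperbolicGroup G → _ := IsHyperbolicGroup.exists_forall_isContracting hS
  refine ⟨?_, h1, fun ⟨D, _, hD⟩ => isHyperbolicGroup_of_isContracting hS hD⟩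
  by_cases hG : IsHyperbolicGroup G
  · exact Or.inl ⟨hG, h1 hG⟩
  by_cases hg : ∃ g : G, IsContractingElement S g
  · refine Or.inr (Or.inr ⟨hG, hg, fun D _ => ?_⟩)
    by_contra! hD
    exact hG (isHyperbolicGroup_of_isContracting hS hD)
  · exact Or.inr (Or.inl hg)
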